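/- Let $k$ be a field, let $e \ge 2$ and $0 \le a \le e^2$ be integers. Call a finite-dimensional local $k$-algebra $A$ (not necessarily commutative) with radical $J$ and $A/J = k$ *short* if $J^3 = 0$, and say that it has *Hilbert type* $(e,a)$ if $J/J^2$ has length $e$ and $J^2$ has length $a$ (as left $A$-modules). All modules are finitely generated left modules. A module $M$ is *reflexive* if the evaluation map $M \to M^{**}$ is bijective, where $M^* = \operatorname{Hom}_A(M, {}_AA)$ and $M^{**} = \operatorname{Hom}(M^*, A_A)$. A complex $(P_i, d_i : P_i \to P_{i-1})_{i\in\mathbb Z}$ of projective modules is *minimal* if the image of each $d_i$ lies in the radical of $P_{i-1}$, and *acyclic* if it is exact everywhere. Then there exists a short local $k$-algebra $A$ of Hilbert type $(e,a)$ such that every reflexive $A$-module is projective and the only acyclic minimal complex of projective $A$-modules is the zero complex. Moreover, $A$ can be chosen of the form $T/U$, where $T = k \oplus E \oplus (E \otimes E)$ is the truncated tensor algebra of an $e$-dimensional vector space $E$ and $U$ is a subspace of $E \otimes E$. -/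

import Mathlib

open CategoryTheory

universe u

/-- `A` is a short local algebra over the field `k`: a finite-dimensional local `k`-algebra (not
necessarily commutative) with radical `J` such that the residue algebra `A / J` is `k` and
`J ^ 3 = 0`. -/
structure IsShortLocalAlgebra (k A : Type*) [Field k] [Ring A] [Algebra k A] : Prop where
  finite : Module.Finite k A
  isLocalRing : IsLocalRing A
  residue : Function.Bijective (algebraMap k (A ⧸ Ring.jacobson A))
  short : Ring.jacobson A ^ 3 = ⊥

/-- `A` is of Hilbert type `(e, a)`: with `J` the radical of `A`, the left `A`-module `J / J ^ 2`
has length `e` and the left `A`-module `J ^ 2` has length `a`. -/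
structure HasHilbertType (A : Type*) [Ring A] (e a : ℕ) : Prop where
  length_top : Module.length A
    (Ring.jacobson A ⧸ Submodule.submoduleOf (Ring.jacobson A ^ 2) (Ring.jacobson A)) = e
  length_sq : Module.length A (Ring.jacobson A ^ 2 : Ideal A) = a

/-- The evaluation map `M → M**`, `m ↦ (f ↦ f m)`, of a left `A`-module `M`. Here
`M* = Hom_A(M, A)` is a right `A`-module, that is, a module over `Aᵐᵒᵖ`, via `(f a)(m) = f(m) a`,
and `M** = Hom(M*, A_A)`, the homomorphisms of right modules, is again a left `A`-module. -/
def bidualEval (A M : Type*) [Ring A] [AddCommGroup M] [Module A M] :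
    M →ₗ[A] ((M →ₗ[A] A) →ₗ[Aᵐᵒᵖ] A) where
  toFun m :=
    { toFun := fun f => f m
      map_add' := fun _ _ => rfl
      map_smul' := fun _ _ => rfl }
  map_add' m n := by
    ext f
    exact map_add f m n
  map_smul' a m := by
    ext f
    exact map_smul f a m

/-- A left `A`-module `M` is reflexive if the evaluation map `M → M**` is bijective. -/
def IsReflexiveModule (A M : Type*) [Ring A] [AddCommGroup M] [Module A M] : Prop :=
  Function.Bijective (bidualEval A M)

/-- `P` is an acyclic minimal complex of (finitely generated) projective left `A`-modules
`⋯ → P₁ → P₀ → P₋₁ → ⋯`, indexed by `ℤ`: it is exact everywhere, and every differential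
`Pᵢ → Pᵢ₋₁` has its image in the radical of `Pᵢ₋₁`. -/
structure IsAcyclicMinimalProjectiveComplex (A : Type u) [Ring A]
    (P : ChainComplex (ModuleCat.{u} A) ℤ) : Prop where
  finite : ∀ i, Module.Finite A (P.X i)
  projective : ∀ i, Module.Projective A (P.X i)
  acyclic : P.Acyclic
  minimal : ∀ i j, LinearMap.range (P.d i j).hom ≤ Module.jacobson A (P.X j)

/-- The relation on the tensor algebra that kills all products of three vectors. -/
inductive TruncatedTensorAlgebra.Rel (k E : Type*) [Field k] [AddCommGroup E] [Module k E] :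
    TensorAlgebra k E → TensorAlgebra k E → Prop
  | triple (x y z : E) : TruncatedTensorAlgebra.Rel k E
      (TensorAlgebra.ι k x * TensorAlgebra.ι k y * TensorAlgebra.ι k z) 0

/-- The truncated tensor algebra `k ⊕ E ⊕ (E ⊗ E)`, the quotient of the tensor algebra of `E` by
the two-sided ideal generated by the products of three vectors. -/
abbrev TruncatedTensorAlgebra (k E : Type*) [Field k] [AddCommGroup E] [Module k E] :=
  RingQuot (TruncatedTensorAlgebra.Rel k E)

/-- The component `E` of the truncated tensor algebra `k ⊕ E ⊕ (E ⊗ E)`. -/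
def TruncatedTensorAlgebra.vectors (k E : Type*) [Field k] [AddCommGroup E] [Module k E] :
    Submodule k (TruncatedTensorAlgebra k E) :=
  LinearMap.range ((RingQuot.mkAlgHom k (TruncatedTensorAlgebra.Rel k E)).toLinearMap ∘ₗ
    TensorAlgebra.ι k)

/-- `A` is isomorphic to `T / U`, where `T = k ⊕ E ⊕ (E ⊗ E)` is the truncated tensor algebra of
`E` and `U` is a subspace of `E ⊗ E`: there is a surjective algebra homomorphism `T → A` whose
kernel lies in `E ⊗ E`. -/
def IsTruncatedTensorQuotient (k E A : Type*) [Field k] [AddCommGroup E] [Module k E]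
    [Ring A] [Algebra k A] : Prop :=
  ∃ f : TruncatedTensorAlgebra k E →ₐ[k] A, Function.Surjective f ∧
    LinearMap.ker f.toLinearMap ≤ TruncatedTensorAlgebra.vectors k E ^ 2

/-! Let `A` have basis `1`, `x_i` (`i < e`) and the first `a` products `x_i x_j` in lexicographic
order, the other products being `0`. This concentrates the products in few rows, so that the
subspaces `S` with `S J = 0` and `S'` with `J S' = 0` are large: `dim S + dim S' ≥ dim A` and `2 dim
S ≥ dim A`.

Everything else is counting. If an `S`-killed module has `t` generators, its dimension is at most `t
(dim A - dim S)`. In an acyclic minimal complex each image is killed by `S` and contains `S P`, of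
dimension `s dim S` for `s` minimal generators of `P`. Comparing the two bounds, the generator
numbers strictly decrease along the differentials while never reaching `0` from a nonzero value,
which is impossible (`lt_of_range_eq_ker`, `eq_zero_of_range_le_jacobson_of_subsingleton`).

For a reflexive `M` without free summand, the same two bounds for `M` and for `M*` contradict each
other unless `M = 0` (`IsReflexiveModule.subsingleton_of_forall_not_isUnit`). In borderline cases
where the inequalities become equalities, the module in question is killed by all of `J`, which
makes it too small. -/

/-! ### Minimal generating families -/

/-- In a shortest generating family, a relation with a unit coefficient would make that generator
redundant. -/
theorem exists_minimal_generators (R M : Type*) [Ring R] [AddCommGroup M] [Module R M]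
    [Module.Finite R M] :
    ∃ (t : ℕ) (m : Fin t → M), Submodule.span R (Set.range m) = ⊤ ∧
      ∀ a : Fin t → R, ∑ i, a i • m i = 0 → ∀ i, ¬ IsUnit (a i) := by
  classical
  have hex : ∃ (t : ℕ) (m : Fin t → M), Submodule.span R (Set.range m) = ⊤ :=
    Module.Finite.exists_fin
  obtain ⟨m, hm⟩ := Nat.find_spec hex
  have hmin := fun t (ht : t < Nat.find hex) => Nat.find_min hex ht
  generalize Nat.find hex = t at m hm hmin
  refine ⟨t, m, hm, fun a ha i hi => ?_⟩
  obtain _ | t := t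
  · exact i.elim0
  refine hmin t t.lt_succ_self ⟨fun j => m (i.succAbove j), ?_⟩
  rw [eq_top_iff, ← hm, Submodule.span_le]
  rintro _ ⟨j, rfl⟩
  by_cases hj : j = i
  · subst hj
    obtain ⟨u, hu⟩ := hi
    rw [Fin.sum_univ_succAbove _ j, ← hu] at ha
    have hmem : (u : R) • m j ∈
        Submodule.span R (Set.range fun l => m (j.succAbove l)) := by
      rw [eq_neg_of_add_eq_zero_left ha]
      exact neg_mem (sum_mem fun l _ => Submodule.smul_mem _ _ (Submodule.subset_span ⟨l, rfl⟩))
    have := Submodule.smul_mem _ (↑u⁻¹ : R) hmem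
    rwa [smul_smul, Units.inv_mul, one_smul] at this
  · obtain ⟨l, rfl⟩ := Fin.exists_succAbove_eq hj
    exact Submodule.subset_span ⟨l, rfl⟩

/-! ### Dimension bounds from annihilating subspaces -/

section Dimension

variable {k R M : Type*} [Field k] [Ring R] [Algebra k R] [AddCommGroup M] [Module R M]
  [Module k M] [IsScalarTower k R M]

/-- The linear combinations of the vectors `m i` with coefficients in a `k`-subspace `S` of `R`. -/
def combinationMap (S : Submodule k R) {t : ℕ} (m : Fin t → M) : (Fin t → S) →ₗ[k] M where
  toFun c := ∑ i, (c i : R) • m i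
  map_add' c d := by simp [add_smul, Finset.sum_add_distrib]
  map_smul' r c := by simp [Finset.smul_sum]

@[simp]
theorem combinationMap_apply (S : Submodule k R) {t : ℕ} (m : Fin t → M) (c : Fin t → S) :
    combinationMap S m c = ∑ i, (c i : R) • m i := rfl

theorem combinationMap_top_surjective {t : ℕ} {m : Fin t → M}
    (hm : Submodule.span R (Set.range m) = ⊤) :
    Function.Surjective (combinationMap (⊤ : Submodule k R) m) := by
  intro x
  have hx : x ∈ Submodule.span R (Set.range m) := hm ▸ Submodule.mem_top
  obtain ⟨c, hc⟩ := (Submodule.mem_span_range_iff_exists_fun R).1 hx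
  exact ⟨fun i => ⟨c i, trivial⟩, hc⟩

/-- For a section `σ` of `R ^ t → M`, each `e_i - σ (m i)` is a relation, so its entries are
nonunits and `S` kills them. Hence `σ` sends `∑ c i • m i` back to `c`. No freeness of projectives
is needed. -/
theorem combinationMap_injective_of_projective [Module.Projective R M] {t : ℕ} {m : Fin t → M}
    (hm : Submodule.span R (Set.range m) = ⊤)
    (hrel : ∀ a : Fin t → R, ∑ i, a i • m i = 0 → ∀ i, ¬ IsUnit (a i))
    (S : Submodule k R) (hS : ∀ s ∈ S, ∀ b : R, ¬ IsUnit b → s * b = 0) :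
    Function.Injective (combinationMap S m) := by
  rw [injective_iff_map_eq_zero]
  intro c hc
  have hsurj : Function.Surjective (Fintype.linearCombination R m) := by
    rw [← LinearMap.range_eq_top, Fintype.range_linearCombination, hm]
  obtain ⟨σ, hσ⟩ := Module.projective_lifting_property (Fintype.linearCombination R m)
    LinearMap.id hsurj
  have hdiff : ∀ i j, ¬ IsUnit (((Pi.single i 1 : Fin t → R) - σ (m i)) j) := by
    intro i
    apply hrel
    have h := LinearMap.congr_fun hσ (m i)
    have h2 : Fintype.linearCombination R m ((Pi.single i 1 : Fin t → R) - σ (m i)) = 0 := by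
      rw [map_sub, Fintype.linearCombination_apply_single]
      simpa [sub_eq_zero] using h.symm
    exact h2
  have h0 : ∑ i, (c i : R) • σ (m i) = 0 := by
    rw [combinationMap_apply] at hc
    simpa using congrArg σ hc
  have h1 : ∑ i, (c i : R) • ((Pi.single i 1 : Fin t → R) - σ (m i)) = 0 :=
    Finset.sum_eq_zero fun i _ => funext fun j => hS _ (c i).2 _ (hdiff i j)
  simp only [smul_sub, Finset.sum_sub_distrib, h0, sub_zero] at h1
  ext j
  simpa [Finset.sum_apply, Pi.single_apply] using congrFun h1 j

variable [Module.Finite k R]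

theorem finrank_fin_fun_submodule (S : Submodule k R) (t : ℕ) :
    Module.finrank k (Fin t → S) = Module.finrank k S * t := by
  simp [Module.finrank_pi_fintype, mul_comm]

/-- `M` is a quotient of `R ^ t` and the kernel contains `S ^ t`. -/
theorem finrank_add_le_of_span_eq_top {t : ℕ} {m : Fin t → M}
    (hm : Submodule.span R (Set.range m) = ⊤) (S : Submodule k R)
    (hS : ∀ s ∈ S, ∀ x : M, s • x = 0) :
    Module.finrank k M + Module.finrank k S * t ≤ Module.finrank k R * t := by
  have h := (combinationMap (⊤ : Submodule k R) m).finrank_range_add_finrank_ker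
  rw [LinearMap.range_eq_top.2 (combinationMap_top_surjective hm), finrank_top,
    finrank_fin_fun_submodule, finrank_top] at h
  let f : (Fin t → S) →ₗ[k] (combinationMap (⊤ : Submodule k R) m).ker :=
    LinearMap.codRestrict _ (LinearMap.compLeft (Submodule.inclusion le_top) (Fin t)) fun c => by
      rw [LinearMap.mem_ker, combinationMap_apply]
      exact Finset.sum_eq_zero fun i _ => hS _ (c i).2 (m i)
  have hf : Function.Injective f := fun c d hcd => by
    ext i
    exact congrArg (fun g => ((g.1 i : (⊤ : Submodule k R)) : R)) hcd
  have := LinearMap.finrank_le_finrank_of_injective hf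
  rw [finrank_fin_fun_submodule] at this
  omega

theorem finrank_mul_le_of_forall_mem [Module.Finite k M] {t : ℕ} {m : Fin t → M}
    {S : Submodule k R} (hinj : Function.Injective (combinationMap S m)) (N : Submodule k M)
    (hN : ∀ s ∈ S, ∀ x : M, s • x ∈ N) :
    Module.finrank k S * t ≤ Module.finrank k N := by
  rw [← finrank_fin_fun_submodule, ← LinearMap.finrank_range_of_inj hinj]
  refine Submodule.finrank_mono ?_
  rintro _ ⟨c, rfl⟩
  rw [combinationMap_apply]
  exact sum_mem fun i _ => hN _ (c i).2 _

end Dimension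

/-- Embedded in a free module, a radical element has all coordinates in the radical of `R`. -/
theorem smul_eq_zero_of_mem_jacobson {R M : Type*} [Ring R] [AddCommGroup M] [Module R M]
    [Module.Projective R M] {s : R} (hs : ∀ b ∈ Ring.jacobson R, s * b = 0) {x : M}
    (hx : x ∈ Module.jacobson R M) : s • x = 0 := by
  obtain ⟨σ, hσ⟩ := Module.projective_def.1 ‹Module.Projective R M›
  apply hσ.injective
  rw [map_zero, map_smul]
  ext p
  exact hs _ (Module.le_comap_jacobson (Finsupp.lapply p ∘ₗ σ) hx)

/-! ### Acyclic minimal complexes -/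

section Complex

variable {k A : Type*} [Field k] [Ring A] [Algebra k A] {Q P N : Type*} [AddCommGroup Q]
  [Module A Q] [AddCommGroup P] [Module A P] [AddCommGroup N] [Module A N]

/-- Here `P` is the image of `f`, hence inside its own radical and killed by `S`, although `S ^ s`
embeds into it. -/
theorem eq_zero_of_range_le_jacobson_of_subsingleton [Module.Projective A P] [Subsingleton N]
    {S : Submodule k A} (hS : ∀ s ∈ S, ∀ b : A, ¬ IsUnit b → s * b = 0)
    (hjac : ∀ b ∈ Ring.jacobson A, ¬ IsUnit b) (hpos : S ≠ ⊥)
    {f : Q →ₗ[A] P} {g : P →ₗ[A] N} (hfg : LinearMap.range f = LinearMap.ker g)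
    (hf : LinearMap.range f ≤ Module.jacobson A P)
    {s : ℕ} {m : Fin s → P} (hm : Submodule.span A (Set.range m) = ⊤)
    (hrel : ∀ a : Fin s → A, ∑ i, a i • m i = 0 → ∀ i, ¬ IsUnit (a i)) : s = 0 := by
  let _ : Module k P := Module.compHom P (algebraMap k A)
  have : IsScalarTower k A P := ⟨fun c a x => by rw [Algebra.smul_def, mul_smul]; rfl⟩
  have hkill : ∀ s ∈ S, ∀ x : P, s • x = 0 := fun s hs x =>
    smul_eq_zero_of_mem_jacobson (fun b hb => hS s hs b (hjac b hb))
      (hf (hfg ▸ LinearMap.mem_ker.2 (Subsingleton.elim _ _)))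
  obtain ⟨c, hc, hc0⟩ := (Submodule.ne_bot_iff S).1 hpos
  by_contra hs
  have hinj := combinationMap_injective_of_projective hm hrel S hS
  have h := @hinj (fun _ => ⟨c, hc⟩) 0 (by simp [hkill c hc])
  exact hc0 (congrArg Subtype.val (congrFun h ⟨0, Nat.pos_of_ne_zero hs⟩))

variable [Module.Finite k A]

/-- The minimal numbers of generators `t` and `s` of consecutive terms `Q → P` of an acyclic
minimal complex of projectives cannot decrease too much in the direction of the differential. -/
theorem lt_of_range_eq_ker [Module.Projective A P] [Module.Projective A N] [Module.Finite A P]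
    {S B : Submodule k A} (hS : ∀ s ∈ S, ∀ b : A, ¬ IsUnit b → s * b = 0)
    (hjac : ∀ b ∈ Ring.jacobson A, ¬ IsUnit b) (hB : ∀ b ∈ B, ¬ IsUnit b)
    (hBA : Module.finrank k B + 1 = Module.finrank k A)
    (hdim : Module.finrank k A < 2 * Module.finrank k S ∨
      Module.finrank k A ≤ 2 * Module.finrank k S ∧ 2 ≤ Module.finrank k S ∧
        ∀ s ∈ S, ∀ b : A, ¬ IsUnit b → b * s = 0)
    {f : Q →ₗ[A] P} {g : P →ₗ[A] N} (hfg : LinearMap.range f = LinearMap.ker g)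
    (hf : LinearMap.range f ≤ Module.jacobson A P) (hg : LinearMap.range g ≤ Module.jacobson A N)
    {t s : ℕ} {q : Fin t → Q} (hq : Submodule.span A (Set.range q) = ⊤)
    {m : Fin s → P} (hm : Submodule.span A (Set.range m) = ⊤)
    (hrel : ∀ a : Fin s → A, ∑ i, a i • m i = 0 → ∀ i, ¬ IsUnit (a i)) (ht : t ≠ 0) :
    s < t := by
  let _ : Module k P := Module.compHom P (algebraMap k A)
  have : IsScalarTower k A P := ⟨fun c a x => by rw [Algebra.smul_def, mul_smul]; rfl⟩
  have : Module.Finite k P := Module.Finite.trans A P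
  have hspan : Submodule.span A (Set.range fun i => f.rangeRestrict (q i)) = ⊤ := by
    have h := congrArg (Submodule.map f.rangeRestrict) hq
    rwa [Submodule.map_span, ← Set.range_comp, Submodule.map_top, LinearMap.range_rangeRestrict]
      at h
  have hinj := combinationMap_injective_of_projective hm hrel S hS
  have hker : ∀ s ∈ S, ∀ x : P, s • x ∈ (LinearMap.range f).restrictScalars k := by
    intro s hs x
    rw [Submodule.restrictScalars_mem, hfg, LinearMap.mem_ker, map_smul]
    exact smul_eq_zero_of_mem_jacobson (fun b hb => hS s hs b (hjac b hb)) (hg ⟨x, rfl⟩)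
  have hlow := finrank_mul_le_of_forall_mem hinj _ hker
  have hup := finrank_add_le_of_span_eq_top hspan S fun s hs x => Subtype.ext <| by
    exact smul_eq_zero_of_mem_jacobson (fun b hb => hS s hs b (hjac b hb)) (hf x.2)
  change Module.finrank k ((LinearMap.range f).restrictScalars k) + _ ≤ _ at hup
  -- With `p = dim S`, the bounds read `p s ≤ dim (im f) ≤ t (dim A - p)`. For `0 < t ≤ s` this is
  -- absurd if `dim A < 2 p`, and forces equality if `dim A = 2 p`.
  by_contra! hts
  rcases hdim with hdim | ⟨hdim, hp, hJS⟩
  · nlinarith [Nat.pos_of_ne_zero ht]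
  · have heq : Module.finrank k ((LinearMap.range f).restrictScalars k) =
        Module.finrank k S * s := by nlinarith
    have hrange : LinearMap.range (combinationMap S m) = (LinearMap.range f).restrictScalars k := by
      refine Submodule.eq_of_le_of_finrank_eq ?_ ?_
      · rintro _ ⟨c, rfl⟩
        rw [combinationMap_apply]
        exact sum_mem fun i _ => hker _ (c i).2 _
      · rw [LinearMap.finrank_range_of_inj hinj, finrank_fin_fun_submodule, heq]
    -- By equality the image of `f` is exactly `S P`, which `B` kills because `B S = 0`. As `B` has
    -- codimension `1`, the image has dimension at most `t`, against `p s ≥ 2 t`.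
    have hB0 := finrank_add_le_of_span_eq_top hspan B fun b hb x => Subtype.ext <| by
      obtain ⟨c, hc⟩ : x.1 ∈ LinearMap.range (combinationMap S m) := hrange ▸ x.2
      change b • x.1 = 0
      rw [← hc, combinationMap_apply, Finset.smul_sum]
      exact Finset.sum_eq_zero fun i _ => by
        rw [smul_smul, hJS _ (c i).2 b (hB b hb), zero_smul]
    change Module.finrank k ((LinearMap.range f).restrictScalars k) + _ ≤ _ at hB0
    rw [← hBA] at hB0
    nlinarith [Nat.pos_of_ne_zero ht]

end Complex

theorem IsAcyclicMinimalProjectiveComplex.isZero {k : Type*} {A : Type u} [Field k] [Ring A]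
    [Algebra k A] [Module.Finite k A] {S B : Submodule k A}
    (hS : ∀ s ∈ S, ∀ b : A, ¬ IsUnit b → s * b = 0)
    (hjac : ∀ b ∈ Ring.jacobson A, ¬ IsUnit b) (hB : ∀ b ∈ B, ¬ IsUnit b)
    (hBA : Module.finrank k B + 1 = Module.finrank k A) (hpos : S ≠ ⊥)
    (hdim : Module.finrank k A < 2 * Module.finrank k S ∨
      Module.finrank k A ≤ 2 * Module.finrank k S ∧ 2 ≤ Module.finrank k S ∧
        ∀ s ∈ S, ∀ b : A, ¬ IsUnit b → b * s = 0)
    {P : ChainComplex (ModuleCat.{u} A) ℤ} (hP : IsAcyclicMinimalProjectiveComplex A P) :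
    Limits.IsZero P := by
  have := hP.finite
  have := hP.projective
  choose t m hm hrel using fun i => exists_minimal_generators A (P.X i)
  have hex : ∀ i, LinearMap.range (P.d (i + 1) i).hom = LinearMap.ker (P.d i (i - 1)).hom := by
    intro i
    have h := (P.exactAt_iff' (i + 1) i (i - 1) (by simp) (by simp)).1 (hP.acyclic i)
    exact h.moduleCat_range_eq_ker
  have hsub : ∀ i, t i = 0 → Subsingleton (P.X i) := by
    intro i hi
    have h := hm i
    have : IsEmpty (Fin (t i)) := hi ▸ Fin.isEmpty'
    rw [Set.range_eq_empty, Submodule.span_empty] at h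
    exact (Submodule.subsingleton_iff A).1 (subsingleton_of_bot_eq_top h)
  have hup : ∀ i, t (i - 1) = 0 → t i = 0 := by
    intro i hi
    have := hsub _ hi
    exact eq_zero_of_range_le_jacobson_of_subsingleton hS hjac hpos (hex i)
      (hP.minimal _ _) (hm i) (hrel i)
  have hlt : ∀ i, t i ≠ 0 → t (i - 1) < t i := by
    intro i hi
    have h := hex (i - 1)
    rw [sub_add_cancel] at h
    exact lt_of_range_eq_ker hS hjac hB hBA hdim h (hP.minimal _ _) (hP.minimal _ _) (hm _) (hm _)
      (hrel _) hi
  -- Infinite descent: a nonzero `t i` would give a smaller, again nonzero `t (i - 1)`.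
  have hzero : ∀ (n : ℕ) (i : ℤ), t i ≤ n → t i = 0 := by
    intro n
    induction n with
    | zero => exact fun i hi => Nat.le_zero.1 hi
    | succ n ih =>
      intro i hi
      by_contra h
      exact h (hup i (ih _ (by have := hlt i h; omega)))
  rw [Limits.IsZero.iff_id_eq_zero]
  ext i x
  have := hsub i (hzero _ i le_rfl)
  exact Subsingleton.elim _ _

/-! ### Reflexive modules -/

/-- For minimal generators, values in a subspace annihilated by nonunits satisfy `h` automatically,
so they can be prescribed freely. -/
theorem exists_linearMap_of_span_eq_top {R N X ι : Type*} [Ring R] [AddCommGroup N] [Module R N]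
    [AddCommGroup X] [Module R X] [Fintype ι] {n : ι → N}
    (hn : Submodule.span R (Set.range n) = ⊤) {x : ι → X}
    (h : ∀ a : ι → R, ∑ i, a i • n i = 0 → ∑ i, a i • x i = 0) :
    ∃ g : N →ₗ[R] X, ∀ i, g (n i) = x i := by
  classical
  have hsurj : Function.Surjective (Fintype.linearCombination R n) := by
    rw [← LinearMap.range_eq_top, Fintype.range_linearCombination, hn]
  refine ⟨(LinearMap.ker (Fintype.linearCombination R n)).liftQ (Fintype.linearCombination R x)
    (fun a ha => LinearMap.mem_ker.2 (h a (LinearMap.mem_ker.1 ha))) ∘ₗ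
    ((Fintype.linearCombination R n).quotKerEquivOfSurjective hsurj).symm.toLinearMap,
    fun i => ?_⟩
  have hi : ((Fintype.linearCombination R n).quotKerEquivOfSurjective hsurj).symm (n i) =
      Submodule.Quotient.mk (Pi.single i 1) := by
    rw [LinearEquiv.symm_apply_eq]
    simp [LinearMap.quotKerEquivOfSurjective]
  rw [LinearMap.comp_apply, LinearEquiv.coe_coe, hi, Submodule.liftQ_apply,
    Fintype.linearCombination_apply_single, one_smul]

/-- A direct summand of a reflexive module is reflexive. -/
theorem IsReflexiveModule.of_retract {A M K : Type*} [Ring A] [AddCommGroup M] [Module A M]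
    [AddCommGroup K] [Module A K] (hM : IsReflexiveModule A M) (i : K →ₗ[A] M) (r : M →ₗ[A] K)
    (hri : ∀ x, r (i x) = x) : IsReflexiveModule A K := by
  constructor
  · intro x y hxy
    have : i x = i y := hM.1 <| LinearMap.ext fun g =>
      (LinearMap.congr_fun hxy (g ∘ₗ i) : (g ∘ₗ i) x = (g ∘ₗ i) y)
    rw [← hri x, this, hri]
  · intro ξ
    let iDual : (M →ₗ[A] A) →ₗ[Aᵐᵒᵖ] (K →ₗ[A] A) :=
      { toFun := fun g => g ∘ₗ i
        map_add' := fun _ _ => rfl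
        map_smul' := fun _ _ => rfl }
    obtain ⟨y, hy⟩ := hM.2 (ξ ∘ₗ iDual)
    refine ⟨r y, LinearMap.ext fun f => ?_⟩
    have h : f (r y) = ξ ((f ∘ₗ r) ∘ₗ i) := LinearMap.congr_fun hy (f ∘ₗ r)
    have hf : (f ∘ₗ r) ∘ₗ i = f := LinearMap.ext fun x => congrArg f (hri x)
    rw [hf] at h
    exact h

section Reflexive

variable {k A : Type*} [Field k] [Ring A] [Algebra k A] [Module.Finite k A]

/-- A space that embeds into `A ^ t` with image containing `S ^ t` has dimension at least `t * dim S`, with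
equality only if the image is `S ^ t`. -/
theorem finrank_mul_le_of_subset_range {V : Type*} [AddCommGroup V] [Module k V]
    {S : Submodule k A} {t : ℕ} {Φ : V →ₗ[k] (Fin t → A)} (hΦ : Function.Injective Φ)
    (h : ∀ c : Fin t → A, (∀ i, c i ∈ S) → ∃ v, Φ v = c) :
    Module.finrank k S * t ≤ Module.finrank k V ∧
      (Module.finrank k S * t = Module.finrank k V → ∀ v i, Φ v i ∈ S) := by
  let j : (Fin t → S) →ₗ[k] (Fin t → A) := LinearMap.compLeft S.subtype (Fin t)
  have hj : Function.Injective j := fun c d hcd => by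
    ext i
    exact congrFun hcd i
  have hle : LinearMap.range j ≤ LinearMap.range Φ := by
    rintro _ ⟨c, rfl⟩
    exact h _ fun i => (c i).2
  have hjr := LinearMap.finrank_range_of_inj hj
  have hΦr := LinearMap.finrank_range_of_inj hΦ
  rw [finrank_fin_fun_submodule] at hjr
  refine ⟨hjr ▸ hΦr ▸ Submodule.finrank_mono hle, fun heq v i => ?_⟩
  have hrange := Submodule.eq_of_le_of_finrank_eq hle (by rw [hjr, hΦr, heq])
  obtain ⟨c, hc⟩ : Φ v ∈ LinearMap.range j := hrange ▸ LinearMap.mem_range_self Φ v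
  rw [← hc]
  exact (c i).2

/-- Let `M` and `M*` have `t` and `s` minimal generators, and put `p = dim S`, `p' = dim S'`, `D =
dim A`. Then `s p ≤ dim M ≤ t (D - p)` and `t p' ≤ dim M* ≤ s (D - p')`. If `D < p + p'` these force
`s = 0`, so `M* = 0` and `M`, which embeds into `A ^ s`, vanishes. -/
theorem IsReflexiveModule.subsingleton_of_forall_not_isUnit {M : Type*} [AddCommGroup M]
    [Module A M] [Module.Finite A M] [Module k M] [IsScalarTower k A M]
    {S S' B : Submodule k A} (hS : ∀ s ∈ S, ∀ b : A, ¬ IsUnit b → s * b = 0)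
    (hS' : ∀ s ∈ S', ∀ b : A, ¬ IsUnit b → b * s = 0) (hB : ∀ b ∈ B, ¬ IsUnit b)
    (hBA : Module.finrank k B + 1 = Module.finrank k A)
    (hdim : Module.finrank k A < Module.finrank k S + Module.finrank k S' ∨
      Module.finrank k A ≤ Module.finrank k S + Module.finrank k S' ∧
        Module.finrank k S' + 2 ≤ Module.finrank k A ∧
        ∀ s ∈ S', ∀ b : A, ¬ IsUnit b → s * b = 0)
    (hM : IsReflexiveModule A M) (hfree : ∀ (f : M →ₗ[A] A) (x : M), ¬ IsUnit (f x)) :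
    Subsingleton M := by
  have : Module.Finite k M := Module.Finite.trans A M
  have : Module.Finite k (M →ₗ[A] A) := Module.Finite.of_injective
    (LinearMap.restrictScalarsₗ k A M A k) (LinearMap.restrictScalars_injective k)
  have : Module.Finite k Aᵐᵒᵖ := Module.Finite.equiv (MulOpposite.opLinearEquiv k)
  have : IsScalarTower k Aᵐᵒᵖ (M →ₗ[A] A) := ⟨fun c a f => by
    ext x
    simp⟩
  have : Module.Finite Aᵐᵒᵖ (M →ₗ[A] A) := Module.Finite.of_restrictScalars_finite k _ _
  obtain ⟨t, m, hm, hmrel⟩ := exists_minimal_generators A M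
  obtain ⟨s, φ, hφ, hφrel⟩ := exists_minimal_generators Aᵐᵒᵖ (M →ₗ[A] A)
  have hop : ∀ T : Submodule k A, Module.finrank k
      (T.map (MulOpposite.opLinearEquiv k : A ≃ₗ[k] Aᵐᵒᵖ).toLinearMap) = Module.finrank k T :=
    fun T => LinearEquiv.finrank_map_eq _ _
  have hopA : Module.finrank k Aᵐᵒᵖ = Module.finrank k A :=
    (MulOpposite.opLinearEquiv k : A ≃ₗ[k] Aᵐᵒᵖ).finrank_eq.symm
  let Φ : M →ₗ[k] (Fin s → A) := LinearMap.pi fun i => (φ i).restrictScalars k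
  have hΦ : Function.Injective Φ := by
    rw [injective_iff_map_eq_zero]
    intro x hx
    apply hM.1
    rw [map_zero]
    ext f
    have hf : f ∈ Submodule.span Aᵐᵒᵖ (Set.range φ) := hφ ▸ Submodule.mem_top
    obtain ⟨c, rfl⟩ := (Submodule.mem_span_range_iff_exists_fun Aᵐᵒᵖ).1 hf
    rw [map_sum]
    refine Finset.sum_eq_zero fun i _ => ?_
    rw [map_smul]
    have : φ i x = 0 := congrFun hx i
    simp [bidualEval, this]
  let Ψ : (M →ₗ[A] A) →ₗ[k] (Fin t → A) :=
    { toFun := fun f i => f (m i)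
      map_add' := fun _ _ => rfl
      map_smul' := fun _ _ => rfl }
  have hΨ : Function.Injective Ψ := fun f g hfg => by
    refine LinearMap.ext_on_range hm fun i => congrFun hfg i
  -- Any `c` in `S ^ s` defines a homomorphism `M* → A` with `φ i ↦ c i`; surjectivity of evaluation
  -- realises it by an element of `M`.
  have hΦS := finrank_mul_le_of_subset_range (S := S) hΦ fun c hc => by
    obtain ⟨g, hg⟩ := exists_linearMap_of_span_eq_top (x := c) hφ fun a ha =>
      Finset.sum_eq_zero fun i _ => hS _ (hc i) _ fun h => hφrel a ha i h.op
    obtain ⟨x, hx⟩ := hM.2 g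
    exact ⟨x, funext fun i => by rw [← hg i, ← hx]; rfl⟩
  have hΨS := finrank_mul_le_of_subset_range (S := S') hΨ fun c hc => by
    obtain ⟨g, hg⟩ := exists_linearMap_of_span_eq_top (x := c) hm fun a ha =>
      Finset.sum_eq_zero fun i _ => hS' _ (hc i) _ (hmrel a ha i)
    exact ⟨g, funext hg⟩
  have hupM := finrank_add_le_of_span_eq_top hm S fun c hc x => hΦ <| by
    rw [map_zero]
    ext i
    change φ i (c • x) = 0
    rw [map_smul, smul_eq_mul, hS c hc _ (hfree _ _)]
  have hupD := finrank_add_le_of_span_eq_top hφ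
    (S'.map (MulOpposite.opLinearEquiv k : A ≃ₗ[k] Aᵐᵒᵖ).toLinearMap) <| by
      rintro _ ⟨c, hc, rfl⟩ f
      ext x
      exact hS' c hc _ (hfree f x)
  rw [hop, hopA] at hupD
  have hs : s = 0 := by
    by_contra hs
    have hs := Nat.pos_of_ne_zero hs
    rcases hdim with hdim | ⟨hdim, hS2, hS'B⟩
    · nlinarith [hΦS.1, hΨS.1]
    -- When `D = p + p'` all the bounds are equalities, so functionals take values in `S'` on the
    -- generators. Then `S' B = 0` makes `B` kill `M*`, so `dim M* ≤ s`, against `dim M* = s (D -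
    -- p') ≥ 2 s`.
    · have hmem := hΨS.2 (by nlinarith [hΦS.1, hΨS.1])
      have hB0 := finrank_add_le_of_span_eq_top hφ
        (B.map (MulOpposite.opLinearEquiv k : A ≃ₗ[k] Aᵐᵒᵖ).toLinearMap) <| by
          rintro _ ⟨b, hb, rfl⟩ f
          refine hΨ ?_
          rw [map_zero]
          ext i
          exact hS'B _ (hmem f i) b (hB b hb)
      rw [hop, hopA, ← hBA] at hB0
      nlinarith [hΦS.1, hΨS.1]
  subst hs
  exact hΦ.subsingleton

/-- A functional with a unit value splits off a copy of `A`; the complement is its kernel, again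
reflexive and of smaller dimension. -/
theorem IsReflexiveModule.projective {S S' B : Submodule k A}
    (hS : ∀ s ∈ S, ∀ b : A, ¬ IsUnit b → s * b = 0)
    (hS' : ∀ s ∈ S', ∀ b : A, ¬ IsUnit b → b * s = 0) (hB : ∀ b ∈ B, ¬ IsUnit b)
    (hBA : Module.finrank k B + 1 = Module.finrank k A)
    (hdim : Module.finrank k A < Module.finrank k S + Module.finrank k S' ∨
      Module.finrank k A ≤ Module.finrank k S + Module.finrank k S' ∧
        Module.finrank k S' + 2 ≤ Module.finrank k A ∧
        ∀ s ∈ S', ∀ b : A, ¬ IsUnit b → s * b = 0) (n : ℕ) (M : Type u) [AddCommGroup M]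
    [Module A M] [Module.Finite A M] [Module k M] [IsScalarTower k A M]
    (hn : Module.finrank k M < n) (hM : IsReflexiveModule A M) : Module.Projective A M := by
  induction n generalizing M with
  | zero => omega
  | succ n ih =>
    by_cases hfree : ∀ (f : M →ₗ[A] A) (x : M), ¬ IsUnit (f x)
    · have := hM.subsingleton_of_forall_not_isUnit hS hS' hB hBA hdim hfree
      infer_instance
    · push Not at hfree
      obtain ⟨f, y, u, hu⟩ := hfree
      obtain ⟨x, hx⟩ : ∃ x, f x = 1 := ⟨(↑u⁻¹ : A) • y, by simp [← hu]⟩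
      have : Module.Finite k M := Module.Finite.trans A M
      let r : M →ₗ[A] LinearMap.ker f := LinearMap.codRestrict _
        (LinearMap.id - (LinearMap.toSpanSingleton A M x) ∘ₗ f) fun z => by simp [hx]
      have hr : ∀ z, (r z : M) = z - f z • x := fun z => rfl
      have hK : IsReflexiveModule A (LinearMap.ker f) :=
        hM.of_retract (LinearMap.ker f).subtype r fun z => Subtype.ext <| by simp [hr]
      have hlt : Module.finrank k (LinearMap.ker f) < Module.finrank k M := by
        refine Submodule.finrank_lt (s := (LinearMap.ker f).restrictScalars k) fun htop => ?_
        have hxk : x ∈ (LinearMap.ker f).restrictScalars k := htop ▸ Submodule.mem_top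
        have h1 : (1 : A) = 0 := hx.symm.trans hxk
        -- `1 = 0` contradicts `dim A = dim B + 1 > 0`.
        have hBtop := Submodule.finrank_le B
        have : Subsingleton A := subsingleton_of_zero_eq_one h1.symm
        have := Module.finrank_zero_of_subsingleton (R := k) (M := A)
        omega
      have : Module.Finite k ((LinearMap.ker f).restrictScalars k) := inferInstance
      have : Module.Finite k (LinearMap.ker f) := this
      have : Module.Finite A (LinearMap.ker f) := Module.Finite.of_restrictScalars_finite k _ _
      have := ih (LinearMap.ker f) (by omega) hK
      refine Module.Projective.of_split (r.prod f)
        ((LinearMap.ker f).subtype.coprod (LinearMap.toSpanSingleton A M x)) ?_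
      ext z
      simp [hr]

end Reflexive

/-! ### The algebra of a bilinear map -/

/-- The graded algebra `k ⊕ V ⊕ W` whose product `V × V → W` is the bilinear map `B`. -/
def BilinearAlgebra {k V W : Type*} [Field k] [AddCommGroup V] [Module k V] [AddCommGroup W]
    [Module k W] (_ : V →ₗ[k] V →ₗ[k] W) := k × V × W

namespace BilinearAlgebra

variable {k V W : Type*} [Field k] [AddCommGroup V] [Module k V] [AddCommGroup W] [Module k W]
  {B : V →ₗ[k] V →ₗ[k] W}

instance : AddCommGroup (BilinearAlgebra B) := inferInstanceAs (AddCommGroup (k × V × W))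

instance : Module k (BilinearAlgebra B) := inferInstanceAs (Module k (k × V × W))

/-- The component in degree `0`. -/
def scalar : BilinearAlgebra B →ₗ[k] k := LinearMap.fst k k (V × W)

/-- The component in degree `1`. -/
def vec : BilinearAlgebra B →ₗ[k] V := LinearMap.fst k V W ∘ₗ LinearMap.snd k k (V × W)

/-- The component in degree `2`. -/
def top : BilinearAlgebra B →ₗ[k] W := LinearMap.snd k V W ∘ₗ LinearMap.snd k k (V × W)

/-- The element with the given components. -/
def mk (c : k) (v : V) (w : W) : BilinearAlgebra B := (c, v, w)

@[simp] theorem scalar_mk (c : k) (v : V) (w : W) : scalar (mk c v w : BilinearAlgebra B) = c := rfl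
@[simp] theorem vec_mk (c : k) (v : V) (w : W) : vec (mk c v w : BilinearAlgebra B) = v := rfl
@[simp] theorem top_mk (c : k) (v : V) (w : W) : top (mk c v w : BilinearAlgebra B) = w := rfl

@[ext]
theorem ext {x y : BilinearAlgebra B} (h₀ : scalar x = scalar y) (h₁ : vec x = vec y)
    (h₂ : top x = top y) : x = y := Prod.ext h₀ (Prod.ext h₁ h₂)

instance : One (BilinearAlgebra B) := ⟨mk 1 0 0⟩

instance : Mul (BilinearAlgebra B) :=
  ⟨fun x y => mk (scalar x * scalar y) (scalar x • vec y + scalar y • vec x)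
    (scalar x • top y + scalar y • top x + B (vec x) (vec y))⟩

@[simp] theorem scalar_one : scalar (1 : BilinearAlgebra B) = 1 := rfl
@[simp] theorem vec_one : vec (1 : BilinearAlgebra B) = 0 := rfl
@[simp] theorem top_one : top (1 : BilinearAlgebra B) = 0 := rfl

@[simp] theorem scalar_mul (x y : BilinearAlgebra B) : scalar (x * y) = scalar x * scalar y := rfl
@[simp] theorem vec_mul (x y : BilinearAlgebra B) :
    vec (x * y) = scalar x • vec y + scalar y • vec x := rfl
@[simp] theorem top_mul (x y : BilinearAlgebra B) :
    top (x * y) = scalar x • top y + scalar y • top x + B (vec x) (vec y) := rfl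

instance : Ring (BilinearAlgebra B) where
  __ := (inferInstance : AddCommGroup (BilinearAlgebra B))
  mul_assoc x y z := by
    ext
    · simp [mul_assoc]
    · simp only [vec_mul, scalar_mul]; module
    · simp only [top_mul, vec_mul, scalar_mul, map_add, map_smul, LinearMap.add_apply,
        LinearMap.smul_apply]
      module
  one_mul x := by ext <;> simp
  mul_one x := by ext <;> simp
  left_distrib x y z := by
    ext
    · simp [mul_add]
    · simp only [vec_mul, map_add]; module
    · simp only [top_mul, map_add]; module
  right_distrib x y z := by
    ext
    · simp [add_mul]
    · simp only [vec_mul, map_add]; module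
    · simp only [top_mul, map_add, LinearMap.add_apply]; module
  zero_mul x := by ext <;> simp
  mul_zero x := by ext <;> simp

instance : Algebra k (BilinearAlgebra B) := Algebra.ofModule
  (fun r x y => by
    ext
    · simp [mul_assoc]
    · simp only [vec_mul, map_smul, smul_eq_mul]; module
    · simp only [top_mul, map_smul, smul_eq_mul, LinearMap.smul_apply]; module)
  (fun r x y => by
    ext
    · simp [mul_left_comm]
    · simp only [vec_mul, map_smul, smul_eq_mul]; module
    · simp only [top_mul, map_smul, smul_eq_mul]; module)

@[simp] theorem scalar_algebraMap (c : k) : scalar (algebraMap k (BilinearAlgebra B) c) = c := by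
  simp [Algebra.algebraMap_eq_smul_one]
@[simp] theorem vec_algebraMap (c : k) : vec (algebraMap k (BilinearAlgebra B) c) = 0 := by
  simp [Algebra.algebraMap_eq_smul_one]
@[simp] theorem top_algebraMap (c : k) : top (algebraMap k (BilinearAlgebra B) c) = 0 := by
  simp [Algebra.algebraMap_eq_smul_one]

instance [Module.Finite k V] [Module.Finite k W] : Module.Finite k (BilinearAlgebra B) :=
  inferInstanceAs (Module.Finite k (k × V × W))

theorem finrank_eq [Module.Finite k V] [Module.Finite k W] :
    Module.finrank k (BilinearAlgebra B) = 1 + Module.finrank k V + Module.finrank k W := by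
  change Module.finrank k (k × V × W) = _
  simp [add_assoc]

theorem isUnit_iff {x : BilinearAlgebra B} : IsUnit x ↔ scalar x ≠ 0 := by
  constructor
  · rintro ⟨u, rfl⟩ h
    have := congrArg scalar u.mul_inv
    rw [scalar_mul, h, zero_mul, scalar_one] at this
    exact zero_ne_one this
  · intro h
    set c := scalar x
    -- The geometric series `(c + n)⁻¹ = c⁻¹ - c⁻² n + c⁻³ n²`, which stops since `n³ = 0`.
    let y : BilinearAlgebra B := mk c⁻¹ (-(c⁻¹ * c⁻¹) • vec x)
      (-(c⁻¹ * c⁻¹) • top x + (c⁻¹ * c⁻¹ * c⁻¹) • B (vec x) (vec x))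
    refine ⟨⟨x, y, ?_, ?_⟩, rfl⟩
    · ext
      · simp [y, c, h]
      · simp only [y, vec_mul, scalar_mk, vec_mk, vec_one, smul_smul, ← add_smul]
        rw [show scalar x = c from rfl]
        field_simp
        simp
      · simp only [y, top_mul, scalar_mk, vec_mk, top_mk, top_one, map_smul]
        rw [show scalar x = c from rfl]
        match_scalars <;> field_simp <;> ring
    · ext
      · simp [y, c, h]
      · simp only [y, vec_mul, scalar_mk, vec_mk, vec_one, smul_smul, ← add_smul]
        rw [show scalar x = c from rfl]
        field_simp
        simp
      · simp only [y, top_mul, scalar_mk, vec_mk, top_mk, top_one, map_smul, LinearMap.smul_apply]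
        rw [show scalar x = c from rfl]
        match_scalars <;> field_simp <;> ring

theorem not_isUnit_iff {x : BilinearAlgebra B} : ¬ IsUnit x ↔ scalar x = 0 := by
  rw [isUnit_iff, not_not]

instance : Nontrivial (BilinearAlgebra B) :=
  ⟨⟨0, 1, fun h => by simpa using congrArg scalar h⟩⟩

instance : IsLocalRing (BilinearAlgebra B) := IsLocalRing.of_nonunits_add fun x y hx hy => by
  rw [mem_nonunits_iff, not_isUnit_iff] at *
  rw [map_add, hx, hy, add_zero]

theorem mem_jacobson_iff {x : BilinearAlgebra B} :
    x ∈ Ring.jacobson (BilinearAlgebra B) ↔ scalar x = 0 := by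
  constructor
  · intro hx
    rw [← not_isUnit_iff]
    exact fun h => (Ring.jacobson_lt_top (BilinearAlgebra B)).ne (Ideal.eq_top_of_isUnit_mem _ hx h)
  · intro hx
    rw [Ring.jacobson_eq_sInf_isMaximal, Ideal.mem_sInf]
    intro I hI
    by_contra hxI
    obtain ⟨y, hy⟩ : ∃ y, 1 - y * x ∈ I := by
      obtain ⟨y, i, hi, h⟩ := Ideal.IsMaximal.exists_inv hI hxI
      exact ⟨y, by rwa [← h, add_sub_cancel_left]⟩
    exact hI.ne_top (Ideal.eq_top_of_isUnit_mem _ hy (isUnit_iff.2 (by simp [hx])))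

end BilinearAlgebra

/-! ### Powers of the radical and Hilbert type -/

/-- The length of a module on which every ring element acts as a scalar of the base field. -/
theorem Module.length_eq_finrank_of_forall_smul_eq {k A M : Type*} [Field k] [Ring A] [Algebra k A]
    [AddCommGroup M] [Module A M] [Module k M] [IsScalarTower k A M] [Module.Finite k M]
    (h : ∀ a : A, ∃ c : k, ∀ x : M, a • x = c • x) :
    Module.length A M = Module.finrank k M := by
  let e : Submodule A M ≃o Submodule k M :=
    { toFun := Submodule.restrictScalars k
      invFun := fun N =>
        { N with
          smul_mem' := fun a x hx => by
            obtain ⟨c, hc⟩ := h a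
            rw [hc]
            exact N.smul_mem c hx }
      left_inv := fun _ => rfl
      right_inv := fun _ => rfl
      map_rel_iff' := Iff.rfl }
  rw [← Module.length_eq_finrank k M]
  apply WithBot.coe_injective
  rw [Module.coe_length, Module.coe_length, Order.krullDim_eq_of_orderIso e]

namespace BilinearAlgebra

variable {k V W : Type*} [Field k] [AddCommGroup V] [Module k V] [AddCommGroup W] [Module k W]
  {B : V →ₗ[k] V →ₗ[k] W}

/-- The inclusion of the component of degree `1`. -/
def ofVec (B : V →ₗ[k] V →ₗ[k] W) : V →ₗ[k] BilinearAlgebra B :=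
  LinearMap.inr k k (V × W) ∘ₗ LinearMap.inl k V W

/-- The inclusion of the component of degree `2`. -/
def ofTop (B : V →ₗ[k] V →ₗ[k] W) : W →ₗ[k] BilinearAlgebra B :=
  LinearMap.inr k k (V × W) ∘ₗ LinearMap.inr k V W

@[simp] theorem scalar_ofVec (v : V) : scalar (ofVec B v) = 0 := rfl
@[simp] theorem vec_ofVec (v : V) : vec (ofVec B v) = v := rfl
@[simp] theorem top_ofVec (v : V) : top (ofVec B v) = 0 := rfl
@[simp] theorem scalar_ofTop (w : W) : scalar (ofTop B w) = 0 := rfl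
@[simp] theorem vec_ofTop (w : W) : vec (ofTop B w) = 0 := rfl
@[simp] theorem top_ofTop (w : W) : top (ofTop B w) = w := rfl

theorem ofVec_mul_ofVec (v v' : V) : ofVec B v * ofVec B v' = ofTop B (B v v') := by
  ext <;> simp

/-- The span of the products of two vectors is the whole component of degree `2`. -/
def Spanning (B : V →ₗ[k] V →ₗ[k] W) : Prop :=
  Submodule.span k (Set.range fun p : V × V => B p.1 p.2) = ⊤

theorem Spanning.ofTop_mem (hB : Spanning B) (N : Submodule k (BilinearAlgebra B))
    (hN : ∀ v v', ofVec B v * ofVec B v' ∈ N) (w : W) : ofTop B w ∈ N := by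
  have h : (⊤ : Submodule k W) ≤ N.comap (ofTop B) := by
    rw [← hB, Submodule.span_le]
    rintro _ ⟨p, rfl⟩
    have := hN p.1 p.2
    rwa [ofVec_mul_ofVec] at this
  exact h Submodule.mem_top

theorem Spanning.mem_jacobson_sq_iff (hB : Spanning B) {x : BilinearAlgebra B} :
    x ∈ Ring.jacobson (BilinearAlgebra B) ^ 2 ↔ scalar x = 0 ∧ vec x = 0 := by
  constructor
  · let I : Ideal (BilinearAlgebra B) :=
      { carrier := {x | scalar x = 0 ∧ vec x = 0}
        add_mem' := fun {x y} hx hy => by simp [hx.1, hx.2, hy.1, hy.2]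
        zero_mem' := by simp
        smul_mem' := fun a x hx => by simp [hx.1, hx.2] }
    have h : Ring.jacobson (BilinearAlgebra B) ^ 2 ≤ I := by
      rw [Submodule.pow_succ, Submodule.pow_one, Ideal.mul_le]
      intro r hr s hs
      rw [mem_jacobson_iff] at hr hs
      exact ⟨by simp [hr], by simp [hr, hs]⟩
    exact fun hx => h hx
  · rintro ⟨h₀, h₁⟩
    have hx : x = ofTop B (top x) := by ext <;> simp [h₀, h₁]
    rw [hx]
    refine hB.ofTop_mem ((Ring.jacobson (BilinearAlgebra B) ^ 2).restrictScalars k)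
      (fun v v' => ?_) _
    rw [Submodule.restrictScalars_mem, Submodule.pow_succ, Submodule.pow_one]
    exact Ideal.mul_mem_mul (mem_jacobson_iff.2 (by simp)) (mem_jacobson_iff.2 (by simp))

theorem Spanning.jacobson_cube (hB : Spanning B) :
    Ring.jacobson (BilinearAlgebra B) ^ 3 = ⊥ := by
  rw [eq_bot_iff, Submodule.pow_succ, Ideal.mul_le]
  intro r hr s hs
  rw [hB.mem_jacobson_sq_iff] at hr
  rw [mem_jacobson_iff] at hs
  rw [Ideal.mem_bot]
  ext <;> simp [hr.1, hr.2, hs]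

theorem Spanning.isShortLocalAlgebra [Module.Finite k V] [Module.Finite k W] (hB : Spanning B) :
    IsShortLocalAlgebra k (BilinearAlgebra B) where
  finite := inferInstance
  isLocalRing := inferInstance
  residue := by
    have : Nontrivial (BilinearAlgebra B ⧸ Ring.jacobson (BilinearAlgebra B)) :=
      Ideal.Quotient.nontrivial_iff.2 (Ring.jacobson_lt_top _).ne
    refine ⟨(algebraMap k _).injective, fun y => ?_⟩
    obtain ⟨x, rfl⟩ := Ideal.Quotient.mk_surjective y
    refine ⟨scalar x, ?_⟩
    have : algebraMap k (BilinearAlgebra B ⧸ Ring.jacobson (BilinearAlgebra B)) (scalar x) =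
      Ideal.Quotient.mk _ (algebraMap k (BilinearAlgebra B) (scalar x)) := rfl
    rw [this, Ideal.Quotient.eq, mem_jacobson_iff]
    simp
  short := hB.jacobson_cube

/-- `J / J ^ 2` and `J ^ 2` are copies of `V` and `W` on which the algebra acts through `scalar`, so
length is dimension over `k`. -/
theorem Spanning.hasHilbertType [Module.Finite k V] [Module.Finite k W] (hB : Spanning B) :
    HasHilbertType (BilinearAlgebra B) (Module.finrank k V) (Module.finrank k W) where
  length_top := by
    let f : V →ₗ[k] (Ring.jacobson (BilinearAlgebra B) ⧸ Submodule.submoduleOf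
        (Ring.jacobson (BilinearAlgebra B) ^ 2) (Ring.jacobson (BilinearAlgebra B))) :=
      { toFun := fun v => Submodule.Quotient.mk ⟨ofVec B v, mem_jacobson_iff.2 (by simp)⟩
        map_add' := fun v v' => by
          rw [← Submodule.Quotient.mk_add]
          congr 1
          ext1
          simp
        map_smul' := fun c v => by
          rw [RingHom.id_apply, ← Submodule.Quotient.mk_smul]
          congr 1
          ext1
          simp }
    have hf : Function.Bijective f := by
      constructor
      · intro v v' h
        have h' := (Submodule.Quotient.eq _).1 h
        have h'' := (hB.mem_jacobson_sq_iff.1 h').2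
        simpa [sub_eq_zero] using h''
      · intro y
        obtain ⟨x, rfl⟩ := Submodule.Quotient.mk_surjective _ y
        refine ⟨vec x.1, (Submodule.Quotient.eq _).2 (hB.mem_jacobson_sq_iff.2 ?_)⟩
        simp [mem_jacobson_iff.1 x.2]
    have : Module.Finite k (Ring.jacobson (BilinearAlgebra B) ⧸ Submodule.submoduleOf
        (Ring.jacobson (BilinearAlgebra B) ^ 2) (Ring.jacobson (BilinearAlgebra B))) :=
      Module.Finite.of_surjective f hf.2
    rw [(LinearEquiv.ofBijective f hf).finrank_eq]
    refine Module.length_eq_finrank_of_forall_smul_eq fun a => ⟨scalar a, fun y => ?_⟩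
    obtain ⟨x, rfl⟩ := Submodule.Quotient.mk_surjective _ y
    rw [← Submodule.Quotient.mk_smul, ← Submodule.Quotient.mk_smul]
    refine (Submodule.Quotient.eq _).2 (hB.mem_jacobson_sq_iff.2 ?_)
    simp [mem_jacobson_iff.1 x.2]
  length_sq := by
    let f : W →ₗ[k] (Ring.jacobson (BilinearAlgebra B) ^ 2 : Ideal (BilinearAlgebra B)) :=
      { toFun := fun w => ⟨ofTop B w, hB.mem_jacobson_sq_iff.2 (by simp)⟩
        map_add' := fun v v' => by ext1; simp
        map_smul' := fun c v => by ext1; simp }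
    have hf : Function.Bijective f := by
      constructor
      · intro w w' h
        exact congrArg (fun z => top z.1) h
      · intro x
        have hx := hB.mem_jacobson_sq_iff.1 x.2
        refine ⟨top x.1, Subtype.ext ?_⟩
        ext <;> simp [f, hx.1, hx.2]
    have : Module.Finite k (Ring.jacobson (BilinearAlgebra B) ^ 2 : Ideal (BilinearAlgebra B)) :=
      Module.Finite.of_surjective f hf.2
    rw [(LinearEquiv.ofBijective f hf).finrank_eq]
    refine Module.length_eq_finrank_of_forall_smul_eq fun a => ⟨scalar a, fun x => Subtype.ext ?_⟩
    have hx := hB.mem_jacobson_sq_iff.1 x.2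
    ext <;> simp [hx.1, hx.2]

end BilinearAlgebra

/-! ### Presentation as a quotient of the truncated tensor algebra -/

theorem TruncatedTensorAlgebra.exists_eq_add {k E : Type*} [Field k] [AddCommGroup E] [Module k E]
    (x : TruncatedTensorAlgebra k E) :
    ∃ c : k, ∃ v : E, ∃ w ∈ vectors k E ^ 2, x = algebraMap k _ c +
      RingQuot.mkAlgHom k (Rel k E) (TensorAlgebra.ι k v) + w := by
  set ι : E →ₗ[k] TruncatedTensorAlgebra k E :=
    (RingQuot.mkAlgHom k (Rel k E)).toLinearMap ∘ₗ TensorAlgebra.ι k with hι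
  have hsq : ∀ y z, ι y * ι z ∈ vectors k E ^ 2 := fun y z => by
    rw [pow_two]
    exact Submodule.mul_mem_mul ⟨y, rfl⟩ ⟨z, rfl⟩
  have htriple : ∀ x y z, ι x * ι y * ι z = 0 := fun x y z => by
    have := RingQuot.mkAlgHom_rel k (Rel.triple (k := k) x y z)
    rwa [map_mul, map_mul, map_zero] at this
  have hcube : ∀ w ∈ vectors k E ^ 2, ∀ z, w * ι z = 0 := fun w hw z => by
    have hle : vectors k E ^ 2 ≤ LinearMap.ker (LinearMap.mulRight k (ι z)) := by
      rw [pow_two, Submodule.mul_le]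
      rintro _ ⟨x, rfl⟩ _ ⟨y, rfl⟩
      exact htriple x y z
    exact hle hw
  obtain ⟨x, rfl⟩ := RingQuot.mkAlgHom_surjective k (Rel k E) x
  -- Elements of the required form are stable under right multiplication by `x`. With `y` arbitrary,
  -- the product case of the induction is just composition; the claim is the case `y = 1`.
  have key : ∀ y : TruncatedTensorAlgebra k E,
      (∃ c : k, ∃ v : E, ∃ w ∈ vectors k E ^ 2, y = algebraMap k _ c + ι v + w) →
      ∃ c : k, ∃ v : E, ∃ w ∈ vectors k E ^ 2,
        y * RingQuot.mkAlgHom k (Rel k E) x = algebraMap k _ c + ι v + w := by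
    induction x using TensorAlgebra.induction with
    | algebraMap r =>
      rintro _ ⟨c, v, w, hw, rfl⟩
      refine ⟨r * c, r • v, r • w, Submodule.smul_mem _ _ hw, ?_⟩
      rw [AlgHom.commutes, ← Algebra.commutes, ← Algebra.smul_def, smul_add, smul_add, map_smul,
        map_mul, ← Algebra.smul_def]
    | ι z =>
      rintro _ ⟨c, v, w, hw, rfl⟩
      refine ⟨0, c • z, ι v * ι z, hsq v z, ?_⟩
      change _ * ι z = _
      rw [add_mul, add_mul, hcube w hw z, map_smul, Algebra.smul_def, map_zero]
      abel
    | mul a b ha hb =>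
      intro y hy
      rw [map_mul, ← mul_assoc]
      exact hb _ (ha _ hy)
    | add a b ha hb =>
      intro y hy
      obtain ⟨c, v, w, hw, h⟩ := ha y hy
      obtain ⟨c', v', w', hw', h'⟩ := hb y hy
      refine ⟨c + c', v + v', w + w', add_mem hw hw', ?_⟩
      rw [map_add, mul_add, h, h', map_add, map_add]
      abel
  have h1 := key 1 ⟨1, 0, 0, zero_mem _, by simp⟩
  rwa [one_mul] at h1

theorem BilinearAlgebra.Spanning.isTruncatedTensorQuotient {k V W : Type*} [Field k]
    [AddCommGroup V] [Module k V] [AddCommGroup W] [Module k W] {B : V →ₗ[k] V →ₗ[k] W}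
    (hB : Spanning B) : IsTruncatedTensorQuotient k V (BilinearAlgebra B) := by
  let g : TensorAlgebra k V →ₐ[k] BilinearAlgebra B := TensorAlgebra.lift k (ofVec B)
  let f : TruncatedTensorAlgebra k V →ₐ[k] BilinearAlgebra B := RingQuot.liftAlgHom k ⟨g, by
    rintro _ _ ⟨x, y, z⟩
    simp only [g, map_mul, TensorAlgebra.lift_ι_apply, map_zero]
    ext <;> simp⟩
  have hf : ∀ v, f (RingQuot.mkAlgHom k _ (TensorAlgebra.ι k v)) = ofVec B v := fun v => by
    simp [f, g, RingQuot.liftAlgHom_mkAlgHom_apply]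
  refine ⟨f, fun x => ?_, fun x hx => ?_⟩
  · have htop : ofTop B (top x) ∈ LinearMap.range f.toLinearMap :=
      hB.ofTop_mem (LinearMap.range f.toLinearMap) (fun v v' => ⟨RingQuot.mkAlgHom k _ (TensorAlgebra.ι k v) *
        RingQuot.mkAlgHom k _ (TensorAlgebra.ι k v'), by
          rw [AlgHom.toLinearMap_apply, map_mul, hf, hf]⟩) _
    obtain ⟨y, hy⟩ := htop
    refine ⟨algebraMap k _ (scalar x) + RingQuot.mkAlgHom k _ (TensorAlgebra.ι k (vec x)) + y, ?_⟩
    rw [AlgHom.toLinearMap_apply] at hy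
    rw [map_add, map_add, hf, hy, AlgHom.commutes]
    ext <;> simp
  -- The degree `0` and `1` components of `f x` are `c` and `v`, so a kernel element reduces to `w`.
  · obtain ⟨c, v, w, hw, rfl⟩ := TruncatedTensorAlgebra.exists_eq_add x
    have hle : TruncatedTensorAlgebra.vectors k V ^ 2 ≤
        (LinearMap.ker (scalar (B := B)) ⊓ LinearMap.ker (vec (B := B))).comap f.toLinearMap := by
      rw [pow_two, Submodule.mul_le]
      rintro _ ⟨x, rfl⟩ _ ⟨y, rfl⟩
      have : f.toLinearMap (RingQuot.mkAlgHom k _ (TensorAlgebra.ι k x) *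
          RingQuot.mkAlgHom k _ (TensorAlgebra.ι k y)) = ofTop B (B x y) := by
        rw [AlgHom.toLinearMap_apply, map_mul, hf, hf, ofVec_mul_ofVec]
      rw [Submodule.mem_comap]
      erw [this]
      simp
    obtain ⟨hw0, hw1⟩ := hle hw
    have hw0 : scalar (f w) = 0 := hw0
    have hw1 : vec (f w) = 0 := hw1
    rw [LinearMap.mem_ker, AlgHom.toLinearMap_apply, map_add, map_add, hf, AlgHom.commutes] at hx
    have h0 := congrArg scalar hx
    have h1 := congrArg vec hx
    simp [hw0, hw1] at h0 h1
    simpa [h0, h1] using hw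

/-! ### Annihilators in the lexicographic algebra -/

namespace BilinearAlgebra

section Subspaces

variable {k V W : Type*} [Field k] [AddCommGroup V] [Module k V] [AddCommGroup W] [Module k W]

/-- The elements of the radical whose component of degree `1` lies in the subspace `X`. -/
def radicalPart (B : V →ₗ[k] V →ₗ[k] W) (X : Submodule k V) : Submodule k (BilinearAlgebra B) :=
  LinearMap.ker scalar ⊓ X.comap vec

theorem mem_radicalPart {B : V →ₗ[k] V →ₗ[k] W} {X : Submodule k V} {x : BilinearAlgebra B} :
    x ∈ radicalPart B X ↔ scalar x = 0 ∧ vec x ∈ X := Iff.rfl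

theorem finrank_radicalPart [Module.Finite k V] [Module.Finite k W] (B : V →ₗ[k] V →ₗ[k] W)
    (X : Submodule k V) :
    Module.finrank k (radicalPart B X) = Module.finrank k X + Module.finrank k W := by
  let f : (X × W) ≃ₗ[k] radicalPart B X :=
    { toFun := fun p => ⟨ofVec B p.1 + ofTop B p.2, by simp [mem_radicalPart]⟩
      map_add' := fun p q => Subtype.ext (by ext <;> simp)
      map_smul' := fun c p => Subtype.ext (by ext <;> simp)
      invFun := fun x => (⟨vec x.1, x.2.2⟩, top x.1)
      left_inv := fun p => Prod.ext (Subtype.ext (by simp)) (by simp)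
      right_inv := fun x => Subtype.ext (by
        have hx : scalar x.1 = 0 := x.2.1
        ext <;> simp [hx]) }
  rw [← f.finrank_eq, Module.finrank_prod]

theorem mul_eq_zero_of_vec {B : V →ₗ[k] V →ₗ[k] W} {x y : BilinearAlgebra B} (hx : scalar x = 0)
    (hy : scalar y = 0) (h : B (vec x) (vec y) = 0) : x * y = 0 := by
  ext <;> simp [hx, hy, h]

end Subspaces

/-- The bilinear map `k ^ e × k ^ e → k ^ a` that sends the first `a` pairs of basis vectors, in
lexicographic order, to the basis vectors of `k ^ a`, and the other pairs to `0`. -/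
def lexProduct (k : Type*) [Field k] {e a : ℕ} (h : a ≤ e ^ 2) :
    (Fin e → k) →ₗ[k] (Fin e → k) →ₗ[k] (Fin a → k) :=
  LinearMap.mk₂ k (fun v w l =>
    v ⟨l / e, Nat.div_lt_of_lt_mul (l.2.trans_le (h.trans_eq (pow_two e)))⟩ *
      w ⟨l % e, Nat.mod_lt _ (Nat.pos_of_ne_zero fun he => by
        have := l.2; subst he; simp at h; omega)⟩)
    (fun _ _ _ => by ext; simp [add_mul]) (fun _ _ _ => by ext; simp [mul_assoc])
    (fun _ _ _ => by ext; simp [mul_add]) (fun _ _ _ => by ext; simp [mul_left_comm])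

variable {k : Type*} [Field k] {e a : ℕ}

theorem spanning_lexProduct (h : a ≤ e ^ 2) : Spanning (lexProduct k h) := by
  classical
  rw [Spanning, eq_top_iff, ← (Pi.basisFun k (Fin a)).span_eq, Submodule.span_le]
  rintro _ ⟨l, rfl⟩
  refine Submodule.subset_span ⟨(Pi.single ⟨l / e, Nat.div_lt_of_lt_mul
    (l.2.trans_le (h.trans_eq (pow_two e)))⟩ 1, Pi.single ⟨l % e, Nat.mod_lt _
      (Nat.pos_of_ne_zero fun he => by have := l.2; subst he; simp at h; omega)⟩ 1), ?_⟩
  ext l'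
  simp only [lexProduct, LinearMap.mk₂_apply, Pi.single_apply, Fin.mk.injEq, Pi.basisFun_apply]
  by_cases hl : l' = l
  · simp [hl]
  · rw [if_neg hl]
    by_cases h1 : (l' : ℕ) / e = l / e
    · have h2 : ¬ (l' : ℕ) % e = l % e := fun h2 => hl <| Fin.ext <| by
        rw [← Nat.div_add_mod l' e, h1, h2, Nat.div_add_mod]
      simp [h2]
    · simp [h1]

/-- The vectors of `k ^ e` whose first `n` coordinates vanish. -/
def tailVectors (k : Type*) [Field k] {e n : ℕ} (h : n ≤ e) : Submodule k (Fin e → k) :=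
  LinearMap.ker (LinearMap.funLeft k k (Fin.castLE h))

theorem apply_eq_zero_of_mem_tailVectors {n : ℕ} {h : n ≤ e} {v : Fin e → k}
    (hv : v ∈ tailVectors k h) {i : Fin e} (hi : (i : ℕ) < n) : v i = 0 :=
  congrFun hv ⟨i, hi⟩

theorem finrank_tailVectors {n : ℕ} (h : n ≤ e) :
    Module.finrank k (tailVectors k h) + n = e := by
  have hs : Function.Surjective (LinearMap.funLeft k k (Fin.castLE h)) :=
    LinearMap.funLeft_surjective_of_injective k k _ (Fin.castLE_injective h)
  have := (LinearMap.funLeft k k (Fin.castLE h)).finrank_range_add_finrank_ker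
  rw [LinearMap.range_eq_top.2 hs, finrank_top, Module.finrank_fin_fun, Module.finrank_fin_fun]
    at this
  rw [tailVectors]
  omega

/-- The first `a ≤ n * e` pairs only involve row indices `l / e < n`. -/
theorem lexProduct_eq_zero_left (h : a ≤ e ^ 2) {n : ℕ} {hn : n ≤ e} (hna : a ≤ n * e)
    {v : Fin e → k} (hv : v ∈ tailVectors k hn) (w : Fin e → k) : lexProduct k h v w = 0 := by
  ext l
  refine mul_eq_zero_of_left (apply_eq_zero_of_mem_tailVectors hv ?_) _
  exact Nat.div_lt_of_lt_mul (by have := l.2; rw [mul_comm]; omega)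

/-- The column indices satisfy `l % e ≤ l < a` as well as `l % e < e`. -/
theorem lexProduct_eq_zero_right (h : a ≤ e ^ 2) {n : ℕ} {hn : n ≤ e} (hna : a ≤ n ∨ n = e)
    {v : Fin e → k} (hv : v ∈ tailVectors k hn) (w : Fin e → k) : lexProduct k h w v = 0 := by
  ext l
  refine mul_eq_zero_of_right _ (apply_eq_zero_of_mem_tailVectors hv ?_)
  rcases hna with hna | rfl
  · exact (Nat.mod_le _ _).trans_lt (l.2.trans_le hna)
  · exact Nat.mod_lt _ (Nat.pos_of_ne_zero fun he => by have := l.2; subst he; simp at h; omega)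

end BilinearAlgebra

/-! ### The theorem -/

open BilinearAlgebra in
theorem proposition14p1 (k : Type u) [Field k] (e a : ℕ) (he : 2 ≤ e) (ha : a ≤ e ^ 2) :
    ∃ (A : Type u) (_ : Ring A) (_ : Algebra k A),
      IsShortLocalAlgebra k A ∧ HasHilbertType A e a ∧
      IsTruncatedTensorQuotient k (Fin e → k) A ∧
      (∀ (M : Type u) [AddCommGroup M] [Module A M] [Module.Finite A M],
        IsReflexiveModule A M → Module.Projective A M) ∧
      (∀ P : ChainComplex (ModuleCat.{u} A) ℤ,
        IsAcyclicMinimalProjectiveComplex A P → Limits.IsZero P) := by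
  have hB := spanning_lexProduct (k := k) ha
  -- All nonzero products lie in the first `n` rows and `n'` columns. For `a > e` the crude choice
  -- `n = n' = e` suffices: `S` and `S'` are then the degree `2` part, of dimension `a`, and `2 a ≥
  -- 1 + e + a`.
  obtain ⟨n, n', hn, hn', hna, hna', hcase⟩ : ∃ n n' : ℕ, n ≤ e ∧ n' ≤ e ∧ a ≤ n * e ∧
      (a ≤ n' ∨ n' = e) ∧ (a = 0 ∧ n = 0 ∧ n' = 0 ∨ 1 ≤ a ∧ n = 1 ∧ n' = a ∨
        e + 1 ≤ a ∧ n = e ∧ n' = e) := by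
    rcases Nat.eq_zero_or_pos a with h0 | h0
    · exact ⟨0, 0, by omega, by omega, by omega, by omega, by omega⟩
    · by_cases h1 : a ≤ e
      · exact ⟨1, a, by omega, by omega, by omega, by omega, by omega⟩
      · exact ⟨e, e, le_rfl, le_rfl, ha.trans_eq (pow_two e), by omega, by omega⟩
  let S := radicalPart (lexProduct k ha) (tailVectors k hn)
  let S' := radicalPart (lexProduct k ha) (tailVectors k hn')
  let J := radicalPart (lexProduct k ha) ⊤
  have hD : Module.finrank k (BilinearAlgebra (lexProduct k ha)) = 1 + e + a := by
    simp [finrank_eq]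
  have hJ : Module.finrank k J = e + a := by simp [J, finrank_radicalPart]
  have hS : Module.finrank k S + n = e + a := by
    have := finrank_tailVectors (k := k) hn
    simp only [S, finrank_radicalPart, Module.finrank_fin_fun]
    omega
  have hS' : Module.finrank k S' + n' = e + a := by
    have := finrank_tailVectors (k := k) hn'
    simp only [S', finrank_radicalPart, Module.finrank_fin_fun]
    omega
  have hleft : ∀ s ∈ S, ∀ b, ¬ IsUnit b → s * b = 0 := fun s hs b hb =>
    mul_eq_zero_of_vec hs.1 (not_isUnit_iff.1 hb) (lexProduct_eq_zero_left ha hna hs.2 _)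
  have hright : ∀ s ∈ S', ∀ b, ¬ IsUnit b → b * s = 0 := fun s hs b hb =>
    mul_eq_zero_of_vec (not_isUnit_iff.1 hb) hs.1 (lexProduct_eq_zero_right ha hna' hs.2 _)
  have hleft' : a ≤ n' * e → ∀ s ∈ S', ∀ b, ¬ IsUnit b → s * b = 0 := fun h s hs b hb =>
    mul_eq_zero_of_vec hs.1 (not_isUnit_iff.1 hb) (lexProduct_eq_zero_left ha h hs.2 _)
  have hright' : (a ≤ n ∨ n = e) → ∀ s ∈ S, ∀ b, ¬ IsUnit b → b * s = 0 := fun h s hs b hb =>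
    mul_eq_zero_of_vec (not_isUnit_iff.1 hb) hs.1 (lexProduct_eq_zero_right ha h hs.2 _)
  have hJu : ∀ b ∈ J, ¬ IsUnit b := fun b hb => not_isUnit_iff.2 hb.1
  refine ⟨BilinearAlgebra (lexProduct k ha), inferInstance, inferInstance,
    hB.isShortLocalAlgebra, ?_, hB.isTruncatedTensorQuotient, ?_, ?_⟩
  · simpa using hB.hasHilbertType
  · intro M _ _ _ hM
    let _ : Module k M := Module.compHom M (algebraMap k (BilinearAlgebra (lexProduct k ha)))
    have : IsScalarTower k (BilinearAlgebra (lexProduct k ha)) M :=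
      ⟨fun c x m => by rw [Algebra.smul_def, mul_smul]; rfl⟩
    refine IsReflexiveModule.projective hleft hright hJu (by omega) ?_ _ M (Nat.lt_succ_self _) hM
    rcases hcase with h | h | h
    · left; omega
    -- Here `dim S + dim S' = (e + a - 1) + e`, which equals `dim A` exactly when `e = 2`.
    · right
      exact ⟨by omega, by omega, hleft' (by rw [h.2.2]; nlinarith)⟩
    · right
      exact ⟨by omega, by omega, hleft' (by rw [h.2.2]; nlinarith)⟩
  · intro P hP
    refine hP.isZero hleft (fun b hb => not_isUnit_iff.2 (mem_jacobson_iff.1 hb)) hJu (by omega)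
      (fun h => ?_) ?_
    · have h0 : Module.finrank k S = 0 := by rw [h, finrank_bot]
      omega
    -- If this fails then `n = 1` and `2 ≤ a ≤ e`, and `2 (e + a - 1) > 1 + e + a` is strict.
    -- Otherwise `S` also satisfies `J S = 0`, as the borderline case demands, unless `a = 0`, where
    -- the inequality is strict anyway.
    · by_cases h1 : a ≤ n ∨ n = e
      · by_cases h0 : a = 0
        · left; omega
        · exact .inr ⟨by omega, by omega, hright' h1⟩
      · left; omega
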